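/- Write points of $\mathbb{R}^{n+1}$ as $z=(x,t)$ with $x\in\mathbb{R}^n$, $t\in\mathbb{R}$, let $\nabla g=(\partial_{x_1}g,\dots,\partial_{x_n}g,\partial_t g)$ be the (weak) space-time gradient, and let $\log^+ s=\max(\log s,0)$ for $s>0$ and $\log^+0=0$. For $m\in\mathbb{N}$ let $W^{2m,m}_2(\mathbb{R}^{n+1})$ be the space of all real $u\in L^2(\mathbb{R}^{n+1})$ whose weak derivatives $\partial_t^r\partial_x^{\beta}u$ lie in $L^2(\mathbb{R}^{n+1})$ for all $r\in\mathbb{N}$ and multi-indices $\beta\in\mathbb{N}^n$ with $2r+|\beta|\le 2m$, with the norm $\|u\|_{W^{2m,m}_2}=\sum_{2r+|\beta|\le 2m}\|\partial_t^r\partial_x^\beta u\|_{L^2}$. For $z\neq0$ let $|z|_a$ be the unique $\mu>0$ with $\sum_{i=1}^n x_i^2/\mu^2+t^2/\mu^4=1$, let $|0|_a=0$, and let $$\|u\|_{BMO^a}=\sup_{Q}\ \inf_{c\in\mathbb{R}}\ \frac1{|Q|}\int_Q|u-c|,$$ the supremum being over all sets $Q=\{z:|z-z_0|_a<r\}$ with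 $z_0\in\mathbb{R}^{n+1}$ and $r>0$. The norm of a vector-valued function $f=(f_1,\dots,f_{n+1})$ is the maximum of the norms of its components. Theorem 3 (Comparison between parabolic logarithmic inequalities). Let $n\in\{1,2,3\}$ and let $m\ge1$ be an integer with $2m>\frac{n+2}{2}$. Let $\mathcal{G}$ be the class of all $g\in L^2(\mathbb{R}^{n+1})$ with $\|g\|_{L^2}\le1$ and $f=\nabla g\in (W^{2m,m}_2(\mathbb{R}^{n+1}))^{n+1}$. (i) There is a constant $C=C(m,n)>0$ such that every $g\in\mathcal{G}$, with $f=\nabla g$, is in $L^\infty(\mathbb{R}^{n+1})$ and satisfies $$\big(\log^+(\|f\|_{W^{2m,m}_2}+\|g\|_{L^\infty})\big)^{1/2}\le C\,\big(1+\log^+\|f\|_{W^{2m,m}_2}\big).$$ (ii) Consequently, on this class the parabolic Ogawa inequality implies the Ibrahim--Monneau inequality, possibly with a different constant: for every $C_0>0$ there is $C_1=C_1(m,n,C_0)>0$ such that, for every $g\in\mathcal{G}$ with $f=\nabla g$, if $$\|f\|_{L^\infty}\le C_0\Big(1+\|f\|_{BMO^a}\big(\log^+(\|f\|_{W^{2m,m}_2}+\|g\|_{L^\infty})\big)^{1/2}\Big),$$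 then $$\|f\|_{L^\infty}\le C_1\Big(1+\|f\|_{BMO^a}\big(1+\log^+\|f\|_{W^{2m,m}_2}\big)\Big).$$ -/

import Mathlib

open MeasureTheory
open scoped ENNReal ContDiff

noncomputable section

namespace ParabolicSobolev

/-- The space-time `ℝⁿ⁺¹`. The coordinates `i.castSucc`, `i : Fin n`, are the spatial ones and
`Fin.last n` is the time coordinate. -/
abbrev SpaceTime (n : ℕ) : Type := EuclideanSpace ℝ (Fin (n + 1))

/-- The classical partial derivative in the `i`-th coordinate. -/
def partialD {n : ℕ} (i : Fin (n + 1)) (φ : SpaceTime n → ℝ) : SpaceTime n → ℝ :=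
  fun z => fderiv ℝ φ z (EuclideanSpace.single i 1)

/-- The classical derivative `∂^α = ∂₁^{α₁} ⋯ ∂ₙ₊₁^{αₙ₊₁}` for a multi-index `α`
(used only on smooth functions, where the order of the derivatives is irrelevant). -/
def iterPartial {n : ℕ} (α : Fin (n + 1) → ℕ) (φ : SpaceTime n → ℝ) : SpaceTime n → ℝ :=
  (List.finRange (n + 1)).foldr (fun i u => (partialD i)^[α i] u) φ

/-- `h` is the weak derivative `∂^α f` on `ℝⁿ⁺¹`. -/
def HasWeakPartial {n : ℕ} (α : Fin (n + 1) → ℕ) (f h : SpaceTime n → ℝ) : Prop :=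
  LocallyIntegrable f volume ∧ LocallyIntegrable h volume ∧
    ∀ φ : SpaceTime n → ℝ, ContDiff ℝ ∞ φ → HasCompactSupport φ →
      ∫ z, f z * iterPartial α φ z = (-1) ^ (∑ i, α i) * ∫ z, h z * φ z

/-- Weak derivatives are unique almost everywhere. -/
theorem HasWeakPartial.ae_unique {n : ℕ} {α : Fin (n + 1) → ℕ} {f h k : SpaceTime n → ℝ}
    (hh : HasWeakPartial α f h) (hk : HasWeakPartial α f k) : h =ᵐ[volume] k := by
  refine ae_eq_of_integral_contDiff_smul_eq hh.2.1 hk.2.1 fun φ hφ hc => ?_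
  have h1 := (hh.2.2 φ hφ hc).symm.trans (hk.2.2 φ hφ hc)
  have h2 := mul_left_cancel₀ (pow_ne_zero _ (by norm_num)) h1
  simpa [smul_eq_mul, mul_comm] using h2

open Classical in
/-- The weak derivative `∂^α f` (unique up to null sets), with value `0` if there is none. -/
def weakPartial {n : ℕ} (α : Fin (n + 1) → ℕ) (f : SpaceTime n → ℝ) : SpaceTime n → ℝ :=
  if h : ∃ k, HasWeakPartial α f k then h.choose else 0

/-- The parabolic order `2r + s` of `∂_t^r ∂_x^s`. -/
def parOrder {n : ℕ} (α : Fin (n + 1) → ℕ) : ℕ :=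
  2 * α (Fin.last n) + ∑ i : Fin n, α i.castSucc

/-- The multi-indices of parabolic order at most `2m`. -/
def parIndices (n m : ℕ) : Finset (Fin (n + 1) → ℕ) :=
  (Fintype.piFinset fun _ => Finset.range (2 * m + 1)).filter fun α => parOrder α ≤ 2 * m

theorem mem_parIndices {n m : ℕ} {α : Fin (n + 1) → ℕ} :
    α ∈ parIndices n m ↔ parOrder α ≤ 2 * m := by
  simp only [parIndices, Finset.mem_filter, Fintype.mem_piFinset, Finset.mem_range,
    and_iff_right_iff_imp]
  intro h i
  unfold parOrder at h
  induction i using Fin.lastCases with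
  | last => omega
  | cast i =>
    have := Finset.single_le_sum (f := fun i : Fin n => α i.castSucc)
      (fun _ _ => Nat.zero_le _) (Finset.mem_univ i)
    omega

/-- `f ∈ W^{2m,m}_2(ℝⁿ⁺¹)`: `f ∈ L²`, and `∂_t^r ∂_x^s f` exists weakly and lies in `L²` whenever
`2r + s ≤ 2m`. -/
def MemW {n : ℕ} (m : ℕ) (f : SpaceTime n → ℝ) : Prop :=
  MemLp f 2 volume ∧
    ∀ α : Fin (n + 1) → ℕ, parOrder α ≤ 2 * m →
      HasWeakPartial α f (weakPartial α f) ∧ MemLp (weakPartial α f) 2 volume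

/-- The norm of `W^{2m,m}_2(ℝⁿ⁺¹)`: the sum of the `L²` norms of all the derivatives
`∂_t^r ∂_x^s f` with `2r + s ≤ 2m`. -/
def normW {n : ℕ} (m : ℕ) (f : SpaceTime n → ℝ) : ℝ≥0∞ :=
  ∑ α ∈ parIndices n m, eLpNorm (weakPartial α f) 2 volume

/-- `|x|²` for the spatial part `x` of `z = (x, t)`. -/
def spatialSq {n : ℕ} (z : SpaceTime n) : ℝ := ∑ i : Fin n, z i.castSucc ^ 2

/-- The parabolic distance function `|z|_a`, `a = (1, …, 1, 2)`. -/
def parNorm {n : ℕ} (z : SpaceTime n) : ℝ :=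
  √((spatialSq z + √(spatialSq z ^ 2 + 4 * z (Fin.last n) ^ 2)) / 2)

theorem parNorm_zero {n : ℕ} : parNorm (0 : SpaceTime n) = 0 := by
  simp [parNorm, spatialSq]

/-- For `z ≠ 0`, `|z|_a` is the unique `μ > 0` with `|x|² / μ² + t² / μ⁴ = 1`. -/
theorem parNorm_eq_iff {n : ℕ} {z : SpaceTime n} (hz : z ≠ 0) (μ : ℝ) :
    parNorm z = μ ↔
      0 < μ ∧ (∑ i : Fin n, z i.castSucc ^ 2 / μ ^ 2) + z (Fin.last n) ^ 2 / μ ^ 4 = 1 := by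
  have hs : 0 ≤ spatialSq z := Finset.sum_nonneg fun _ _ => sq_nonneg _
  have hpos : 0 < spatialSq z + z (Fin.last n) ^ 2 := by
    by_contra hcon
    have ht : z (Fin.last n) = 0 := by nlinarith [sq_nonneg (z (Fin.last n))]
    have hs0 : spatialSq z = 0 := by nlinarith [sq_nonneg (z (Fin.last n))]
    apply hz
    ext i
    induction i using Fin.lastCases with
    | last => simpa using ht
    | cast i =>
      have := (Finset.sum_eq_zero_iff_of_nonneg (fun i _ => sq_nonneg _)).1 hs0 i
        (Finset.mem_univ i)
      simpa using this
  rw [← Finset.sum_div]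
  change _ ↔ 0 < μ ∧ spatialSq z / μ ^ 2 + z (Fin.last n) ^ 2 / μ ^ 4 = 1
  unfold parNorm
  set S := spatialSq z
  set t := z (Fin.last n)
  have hD : 0 ≤ S ^ 2 + 4 * t ^ 2 := by positivity
  have hR := Real.sq_sqrt hD
  have hR0 := Real.sqrt_nonneg (S ^ 2 + 4 * t ^ 2)
  set R := √(S ^ 2 + 4 * t ^ 2)
  have hSR : 0 < S + R := by
    by_contra hcon
    have hS0 : S = 0 := by linarith
    have hR1 : R = 0 := by linarith
    rw [hS0, hR1] at hR
    nlinarith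
  have key : ∀ ν : ℝ, 0 < ν → (S / ν ^ 2 + t ^ 2 / ν ^ 4 = 1 ↔ ν ^ 2 = (S + R) / 2) := by
    intro ν hν
    have e : S / ν ^ 2 + t ^ 2 / ν ^ 4 = 1 ↔ S * ν ^ 2 + t ^ 2 = ν ^ 4 := by
      field_simp
    rw [e]
    constructor
    · intro h
      have h1 : (2 * ν ^ 2 - S - R) * (2 * ν ^ 2 - S + R) = 0 := by nlinarith
      rcases mul_eq_zero.1 h1 with h2 | h2
      · linarith
      · have hν2 : 0 < ν ^ 2 := by positivity
        have hRS : R ≤ S := by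
          by_contra hc
          linarith
        have hSR' : S ≤ R := by nlinarith [sq_nonneg t]
        linarith
    · intro h
      have h4 : ν ^ 4 = (ν ^ 2) ^ 2 := by ring
      rw [h4, h]
      nlinarith
  constructor
  · rintro rfl
    have h0 : 0 < √((S + R) / 2) := Real.sqrt_pos.2 (by linarith)
    exact ⟨h0, (key _ h0).2 (Real.sq_sqrt (by linarith))⟩
  · rintro ⟨h0, h1⟩
    rw [← (key μ h0).1 h1, Real.sqrt_sq h0.le]

/-- The parabolic cube `Q_r(z₀) = {z : |z - z₀|_a < r}`. -/
def parCube {n : ℕ} (z₀ : SpaceTime n) (r : ℝ) : Set (SpaceTime n) :=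
  {z | parNorm (z - z₀) < r}

/-- The parabolic `BMO` (semi-)norm of a locally integrable function on `ℝⁿ⁺¹`. -/
def normBMO {n : ℕ} (f : SpaceTime n → ℝ) : ℝ≥0∞ :=
  ⨆ (z₀ : SpaceTime n) (r : ℝ) (_ : 0 < r), ⨅ c : ℝ,
    (volume (parCube z₀ r))⁻¹ * ∫⁻ z in parCube z₀ r, ‖f z - c‖ₑ

/-- The `L^∞` norm. -/
def normLinf {n : ℕ} (f : SpaceTime n → ℝ) : ℝ≥0∞ := eLpNorm f ∞ volume

/-- The norm of a vector-valued function: the maximum of the norms of its components. -/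
def vecNorm {n : ℕ} (N : (SpaceTime n → ℝ) → ℝ≥0∞) (f : Fin (n + 1) → SpaceTime n → ℝ) : ℝ≥0∞ :=
  Finset.univ.sup fun i => N (f i)

/-- `f = ∇g` in the weak sense, with `∇` the full space-time gradient. -/
def IsWeakGradient {n : ℕ} (g : SpaceTime n → ℝ) (f : Fin (n + 1) → SpaceTime n → ℝ) : Prop :=
  ∀ i, HasWeakPartial (Pi.single i 1) g (f i)

/-- The pairs `(g, f)` with `g ∈ L²`, `‖g‖_{L²} ≤ 1` and `f = ∇g ∈ W^{2m,m}_2`. -/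
structure Admissible {n : ℕ} (m : ℕ) (g : SpaceTime n → ℝ)
    (f : Fin (n + 1) → SpaceTime n → ℝ) : Prop where
  memLp : MemLp g 2 volume
  norm_le_one : eLpNorm g 2 volume ≤ 1
  isWeakGradient : IsWeakGradient g f
  memW : ∀ i, MemW m (f i)

/-- The real number `‖f‖_{W^{2m,m}_2}` of a vector-valued function. -/
def wNorm {n : ℕ} (m : ℕ) (f : Fin (n + 1) → SpaceTime n → ℝ) : ℝ :=
  (vecNorm (normW m) f).toReal

/-- The real number `(log⁺ (‖f‖_{W^{2m,m}_2} + ‖g‖_{L^∞}))^{1/2}` (for bounded `g`). -/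
def sqrtLogTerm {n : ℕ} (m : ℕ) (g : SpaceTime n → ℝ)
    (f : Fin (n + 1) → SpaceTime n → ℝ) : ℝ :=
  √(Real.posLog (wNorm m f + (normLinf g).toReal))

/-- The parabolic Ogawa inequality for `(g, f)` with the constant `C`:
`‖f‖_∞ ≤ C (1 + ‖f‖_{BMO} (log⁺ (‖f‖_W + ‖g‖_∞))^{1/2})`. -/
def OgawaInequality {n : ℕ} (m : ℕ) (C : ℝ) (g : SpaceTime n → ℝ)
    (f : Fin (n + 1) → SpaceTime n → ℝ) : Prop :=
  vecNorm normLinf f ≤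
    ENNReal.ofReal C * (1 + vecNorm normBMO f * ENNReal.ofReal (sqrtLogTerm m g f))

/-- The parabolic logarithmic Sobolev inequality for `f` with the constant `C`:
`‖f‖_∞ ≤ C (1 + ‖f‖_{BMO} (1 + log⁺ ‖f‖_W))`. -/
def LogSobolevInequality {n : ℕ} (m : ℕ) (C : ℝ)
    (f : Fin (n + 1) → SpaceTime n → ℝ) : Prop :=
  vecNorm normLinf f ≤
    ENNReal.ofReal C * (1 + vecNorm normBMO f * ENNReal.ofReal (1 + Real.posLog (wNorm m f)))

end ParabolicSobolev

end

open ParabolicSobolev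

namespace ParabolicSobolev

open scoped Convolution

/-! ### Iterated partial derivatives along a list of coordinates -/

/-! Everything rests on the bound `‖g‖_∞ ≤ 2 ^ (n + 1) * (1 + ‖f‖_W)`; after it, part (i) is
calculus with `log⁺` and part (ii) is substitution.

For smooth `u`, the one-variable bound `|v a|² ≤ 2 ∫ (v² + v'²)` applied in each coordinate in turn
controls `|u z|²` by the squared `L²` norms of the mixed derivatives `∂^α u`, `α ∈ {0, 1}ⁿ⁺¹`
(`enorm_sq_le_sum_lintegral`). Mollification carries this over to `g` without increasing the `L²`
norms (`normLinf_le_of_weak_listPartial`).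

For `α = 0` the norm is at most `1` by hypothesis. Any other `∂^α g` is a derivative of some `f i`
in the remaining coordinates, of parabolic order at most `n + 1`. For `n ≤ 3` the hypotheses on `m`
force `n + 1 ≤ 2 * m`, so the `W` norm controls it. -/

/-- The iterated derivative `∂_{i₁} ⋯ ∂_{iₖ}` along a list of coordinates. -/
noncomputable def listPartial {n : ℕ} (s : List (Fin (n + 1))) (φ : SpaceTime n → ℝ) : SpaceTime n → ℝ :=
  s.foldr partialD φ

/-- The multi-index which is `1` on a list of coordinates and `0` elsewhere. -/
def listIndex {n : ℕ} (s : List (Fin (n + 1))) : Fin (n + 1) → ℕ := fun i => if i ∈ s then 1 else 0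

@[simp] theorem listPartial_nil {n : ℕ} (φ : SpaceTime n → ℝ) : listPartial [] φ = φ := rfl

@[simp] theorem listPartial_cons {n : ℕ} (i : Fin (n + 1)) (s : List (Fin (n + 1)))
    (φ : SpaceTime n → ℝ) : listPartial (i :: s) φ = partialD i (listPartial s φ) := rfl

/-- A duplicate-free `l` meets each coordinate once, with exponent 0 or 1. A sublist keeps the order
of `l`, so no derivatives need to be commuted. -/
theorem foldr_iterate_listIndex {n : ℕ} {s l : List (Fin (n + 1))} (hsl : s.Sublist l)
    (hl : l.Nodup) (φ : SpaceTime n → ℝ) :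
    l.foldr (fun i u => (partialD i)^[listIndex s i] u) φ = listPartial s φ := by
  induction hsl with
  | slnil => rfl
  | @cons s l i h ih =>
    have hi : i ∉ s := fun hs => (List.nodup_cons.1 hl).1 (h.subset hs)
    rw [List.foldr_cons, ih (List.nodup_cons.1 hl).2]
    simp [listIndex, hi]
  | @cons_cons s l i h ih =>
    have hi := (List.nodup_cons.1 hl).1
    have : l.foldr (fun j u => (partialD j)^[listIndex (i :: s) j] u) φ
        = l.foldr (fun j u => (partialD j)^[listIndex s j] u) φ := by
      refine List.foldr_ext _ _ _ fun j hj u => ?_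
      have hji : j ≠ i := fun e => hi (e ▸ hj)
      simp [listIndex, hji]
    rw [List.foldr_cons, this, ih (List.nodup_cons.1 hl).2]
    simp [listIndex]

theorem iterPartial_listIndex {n : ℕ} {s : List (Fin (n + 1))}
    (hs : s.Sublist (List.finRange (n + 1))) (φ : SpaceTime n → ℝ) :
    iterPartial (listIndex s) φ = listPartial s φ :=
  foldr_iterate_listIndex hs (List.nodup_finRange _) φ

theorem listIndex_singleton {n : ℕ} (i : Fin (n + 1)) : listIndex [i] = Pi.single i 1 := by
  ext j
  simp [listIndex, Pi.single_apply]

theorem sum_listIndex {n : ℕ} {s : List (Fin (n + 1))} (hs : s.Nodup) :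
    ∑ i, listIndex s i = s.length := by
  have : ∀ i, listIndex s i = if i ∈ s.toFinset then 1 else 0 := by simp [listIndex]
  simp_rw [this]
  rw [Finset.sum_ite_mem, Finset.univ_inter, Finset.sum_const, smul_eq_mul, mul_one,
    List.toFinset_card_of_nodup hs]

/-- The all-ones multi-index has parabolic order `n + 2`, and omitting any one coordinate lowers it
by at least 1. -/
theorem parOrder_listIndex_le {n : ℕ} {s : List (Fin (n + 1))} {i : Fin (n + 1)} (hi : i ∉ s) :
    parOrder (listIndex s) ≤ n + 1 := by
  have hle : ∀ j, listIndex s j ≤ 1 := fun j => by unfold listIndex; split_ifs <;> omega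
  have h0 : listIndex s i = 0 := by simp [listIndex, hi]
  unfold parOrder
  induction i using Fin.lastCases with
  | last =>
    have : ∑ j : Fin n, listIndex s j.castSucc ≤ ∑ _j : Fin n, 1 :=
      Finset.sum_le_sum fun j _ => hle _
    simp only [Finset.sum_const, Finset.card_univ, Fintype.card_fin, smul_eq_mul, mul_one] at this
    omega
  | cast i =>
    have h1 := hle (Fin.last n)
    have : ∑ j : Fin n, listIndex s j.castSucc < ∑ _j : Fin n, 1 :=
      Finset.sum_lt_sum (fun j _ => hle _) ⟨i, Finset.mem_univ _, by omega⟩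
    simp only [Finset.sum_const, Finset.card_univ, Fintype.card_fin, smul_eq_mul, mul_one] at this
    omega

theorem contDiff_partialD {n : ℕ} {φ : SpaceTime n → ℝ} (hφ : ContDiff ℝ ∞ φ)
    (i : Fin (n + 1)) : ContDiff ℝ ∞ (partialD i φ) :=
  (hφ.fderiv_right (m := ∞) (by simp)).clm_apply contDiff_const

theorem contDiff_listPartial {n : ℕ} {φ : SpaceTime n → ℝ} (hφ : ContDiff ℝ ∞ φ)
    (s : List (Fin (n + 1))) : ContDiff ℝ ∞ (listPartial s φ) := by
  induction s with
  | nil => exact hφ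
  | cons i s ih => exact contDiff_partialD ih i

theorem hasCompactSupport_partialD {n : ℕ} {φ : SpaceTime n → ℝ} (hφ : HasCompactSupport φ)
    (i : Fin (n + 1)) : HasCompactSupport (partialD i φ) :=
  hφ.fderiv_apply ℝ _

theorem hasCompactSupport_listPartial {n : ℕ} {φ : SpaceTime n → ℝ} (hφ : HasCompactSupport φ)
    (s : List (Fin (n + 1))) : HasCompactSupport (listPartial s φ) := by
  induction s with
  | nil => exact hφ
  | cons i s ih => exact hasCompactSupport_partialD ih i

theorem partialD_reflect {n : ℕ} {φ : SpaceTime n → ℝ} (hφ : Differentiable ℝ φ)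
    (z : SpaceTime n) (c : ℝ) (i : Fin (n + 1)) :
    partialD i (fun t => c * φ (z - t)) = fun t => -c * partialD i φ (z - t) := by
  ext t
  have h := (((hφ (z - t)).hasFDerivAt.comp t ((hasFDerivAt_id t).const_sub z)).const_mul c).fderiv
  unfold partialD
  refine (congrArg (fun T => T (EuclideanSpace.single i 1)) h).trans ?_
  simp

/-- The chain-rule sign here cancels the sign in the definition of a weak derivative when `t ↦ φ (z
- t)` is the test function. -/
theorem listPartial_reflect {n : ℕ} {φ : SpaceTime n → ℝ} (hφ : ContDiff ℝ ∞ φ)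
    (z : SpaceTime n) (s : List (Fin (n + 1))) :
    listPartial s (fun t => φ (z - t)) = fun t => (-1) ^ s.length * listPartial s φ (z - t) := by
  induction s with
  | nil => simp
  | cons i s ih =>
    rw [listPartial_cons, ih,
      partialD_reflect ((contDiff_listPartial hφ s).differentiable (by simp))]
    ext t
    rw [listPartial_cons, List.length_cons, pow_succ]
    ring

/-! ### Mollification and weak derivatives -/

/-- The convolution of two real functions on space-time. -/
noncomputable def conv {n : ℕ} (g φ : SpaceTime n → ℝ) : SpaceTime n → ℝ :=
  g ⋆[ContinuousLinearMap.mul ℝ ℝ, volume] φ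

theorem conv_apply {n : ℕ} (g φ : SpaceTime n → ℝ) (z : SpaceTime n) :
    conv g φ z = ∫ t, g t * φ (z - t) := rfl

theorem contDiff_conv {n : ℕ} {g φ : SpaceTime n → ℝ} (hg : LocallyIntegrable g volume)
    (hφ : ContDiff ℝ ∞ φ) (hc : HasCompactSupport φ) : ContDiff ℝ ∞ (conv g φ) :=
  hc.contDiff_convolution_right _ hg hφ

theorem partialD_conv {n : ℕ} {g φ : SpaceTime n → ℝ} (hg : LocallyIntegrable g volume)
    (hφ : ContDiff ℝ ∞ φ) (hc : HasCompactSupport φ) (i : Fin (n + 1)) :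
    partialD i (conv g φ) = conv g (partialD i φ) := by
  ext z
  have h1 : ContDiff ℝ 1 φ := hφ.of_le (by exact_mod_cast le_top)
  have := hc.hasFDerivAt_convolution_right (ContinuousLinearMap.mul ℝ ℝ) hg h1 z
  unfold partialD conv
  rw [this.fderiv, convolution_precompR_apply _ hg (hc.fderiv ℝ) (h1.continuous_fderiv one_ne_zero)]

theorem listPartial_conv {n : ℕ} {g φ : SpaceTime n → ℝ} (hg : LocallyIntegrable g volume)
    (hφ : ContDiff ℝ ∞ φ) (hc : HasCompactSupport φ) (s : List (Fin (n + 1))) :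
    listPartial s (conv g φ) = conv g (listPartial s φ) := by
  induction s with
  | nil => rfl
  | cons i s ih =>
    rw [listPartial_cons, ih, partialD_conv hg (contDiff_listPartial hφ s)
      (hasCompactSupport_listPartial hc s), listPartial_cons]

/-- A weak derivative can be moved onto the other factor of a convolution. -/
theorem conv_listPartial_of_weak {n : ℕ} {g h φ : SpaceTime n → ℝ} {s : List (Fin (n + 1))}
    (H : ∀ ψ : SpaceTime n → ℝ, ContDiff ℝ ∞ ψ → HasCompactSupport ψ →
      ∫ z, g z * listPartial s ψ z = (-1) ^ s.length * ∫ z, h z * ψ z)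
    (hφ : ContDiff ℝ ∞ φ) (hc : HasCompactSupport φ) :
    conv g (listPartial s φ) = conv h φ := by
  ext z
  have := H (fun t => φ (z - t)) (hφ.comp (contDiff_const.sub contDiff_id))
    (hc.comp_homeomorph (Homeomorph.subLeft z))
  rw [listPartial_reflect hφ] at this
  have e : ∀ t, g t * ((-1) ^ s.length * listPartial s φ (z - t))
      = (-1) ^ s.length * (g t * listPartial s φ (z - t)) := fun t => by ring
  simp_rw [e] at this
  rw [integral_const_mul] at this
  exact mul_left_cancel₀ (pow_ne_zero _ (by norm_num)) this

/-- The Cauchy-Schwarz inequality with a weight. -/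
theorem sq_lintegral_mul_le {α : Type*} [MeasurableSpace α] {μ : Measure α} {f w : α → ℝ≥0∞}
    (hf : AEMeasurable f μ) (hw : AEMeasurable w μ) :
    (∫⁻ a, f a * w a ∂μ) ^ 2 ≤ (∫⁻ a, f a ^ 2 * w a ∂μ) * ∫⁻ a, w a ∂μ := by
  have h := ENNReal.lintegral_mul_norm_pow_le (μ := μ) (f := fun a => f a ^ 2 * w a) (g := w)
    ((hf.pow_const 2).mul hw) hw (p := 2⁻¹) (q := 2⁻¹) (by norm_num) (by norm_num) (by norm_num)
  have hsq : ∀ x : ℝ≥0∞, (x ^ (2⁻¹ : ℝ)) ^ 2 = x := fun x => by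
    rw [← ENNReal.rpow_natCast, ← ENNReal.rpow_mul]; norm_num
  have hsq' : ∀ x : ℝ≥0∞, (x ^ 2) ^ (2⁻¹ : ℝ) = x := fun x => by
    rw [← ENNReal.rpow_natCast, ← ENNReal.rpow_mul]; norm_num
  have e : ∀ a, (f a ^ 2 * w a) ^ (2⁻¹ : ℝ) * w a ^ (2⁻¹ : ℝ) = f a * w a := fun a => by
    rw [ENNReal.mul_rpow_of_nonneg _ _ (by norm_num), hsq', mul_assoc, ← pow_two, hsq]
  simp_rw [e] at h
  calc _ ≤ _ := pow_le_pow_left₀ zero_le h 2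
    _ = _ := by rw [mul_pow, hsq, hsq]

theorem lintegral_enorm_sq {α : Type*} [MeasurableSpace α] {μ : Measure α} (f : α → ℝ) :
    ∫⁻ a, ‖f a‖ₑ ^ 2 ∂μ = eLpNorm f 2 μ ^ 2 := by
  have := eLpNorm_nnreal_pow_eq_lintegral (f := f) (μ := μ) (p := 2) two_ne_zero
  simpa using this.symm

/-- Young's inequality for a kernel of mass one: Cauchy-Schwarz for the weight `|φ (z - t)|`, then
Tonelli. -/
theorem lintegral_conv_sq_le {n : ℕ} {h φ : SpaceTime n → ℝ}
    (hh : AEStronglyMeasurable h volume) (hφ : Measurable φ) (h1 : ∫⁻ z, ‖φ z‖ₑ = 1) :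
    ∫⁻ z, ‖conv h φ z‖ₑ ^ 2 ≤ eLpNorm h 2 volume ^ 2 := by
  have hm : AEMeasurable (fun t => ‖h t‖ₑ) volume := hh.enorm
  have hshift : ∀ z : SpaceTime n, ∫⁻ t, ‖φ (z - t)‖ₑ = 1 := fun z => by
    rw [← h1]
    exact lintegral_sub_left_eq_self (fun t => ‖φ t‖ₑ) z
  calc ∫⁻ z, ‖conv h φ z‖ₑ ^ 2 ≤ ∫⁻ z, ∫⁻ t, ‖h t‖ₑ ^ 2 * ‖φ (z - t)‖ₑ := by
        refine lintegral_mono fun z => ?_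
        have hz : ‖conv h φ z‖ₑ ≤ ∫⁻ t, ‖h t‖ₑ * ‖φ (z - t)‖ₑ := by
          rw [conv_apply]
          refine (enorm_integral_le_lintegral_enorm _).trans (le_of_eq ?_)
          simp_rw [enorm_mul]
        calc ‖conv h φ z‖ₑ ^ 2 ≤ (∫⁻ t, ‖h t‖ₑ * ‖φ (z - t)‖ₑ) ^ 2 := pow_le_pow_left₀ zero_le hz 2
          _ ≤ _ := sq_lintegral_mul_le hm (by fun_prop)
          _ = _ := by rw [hshift, mul_one]
    _ = ∫⁻ t, ∫⁻ z, ‖h t‖ₑ ^ 2 * ‖φ (z - t)‖ₑ := by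
        refine lintegral_lintegral_swap ?_
        have hm2 : AEMeasurable (fun p : SpaceTime n × SpaceTime n => ‖h p.2‖ₑ ^ 2)
            (volume.prod volume) := (hm.pow_const 2).comp_snd
        exact hm2.mul (by fun_prop)
    _ = ∫⁻ t, ‖h t‖ₑ ^ 2 := by
        refine lintegral_congr fun t => ?_
        rw [lintegral_const_mul _ (by fun_prop),
          lintegral_sub_right_eq_self (fun z => ‖φ z‖ₑ) t, h1, mul_one]
    _ = _ := lintegral_enorm_sq h

/-! ### A pointwise bound by `L²` norms of mixed derivatives -/

theorem enorm_sq_le_lintegral_line {v v' : ℝ → ℝ} (hv : ∀ s, HasDerivAt v (v' s) s)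
    (hv' : Continuous v') (a : ℝ) :
    ‖v a‖ₑ ^ 2 ≤ 2 * ∫⁻ s, (‖v s‖ₑ ^ 2 + ‖v' s‖ₑ ^ 2) := by
  have hvc : Continuous v := continuous_iff_continuousAt.2 fun s => (hv s).continuousAt
  -- The factor `s - (a + 1)` vanishes at `a + 1` and is `-1` at `a`, so integrating this derivative
  -- over `[a, a + 1]` leaves exactly `v a`.
  have hF : ∀ s, HasDerivAt (fun s => (s - (a + 1)) * v s) (v s + (s - (a + 1)) * v' s) s :=
    fun s => by
      have := ((hasDerivAt_id s).sub_const (a + 1)).mul (hv s)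
      rw [one_mul] at this
      exact this
  have hftc := intervalIntegral.integral_eq_sub_of_hasDerivAt (a := a) (b := a + 1)
    (fun s _ => hF s) ((by fun_prop : Continuous fun s => v s + (s - (a + 1)) * v' s)
      |>.intervalIntegrable _ _)
  have hva : v a = ∫ s in Set.Ioc a (a + 1), (v s + (s - (a + 1)) * v' s) := by
    rw [← intervalIntegral.integral_of_le (by linarith), hftc]
    ring
  -- The weight 1 puts the integral in the form required by Cauchy-Schwarz; its mass is the interval
  -- length, 1.
  have hle : ‖v a‖ₑ ≤ ∫⁻ s in Set.Ioc a (a + 1), (‖v s‖ₑ + ‖v' s‖ₑ) * 1 := by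
    conv_lhs => rw [hva]
    refine (enorm_integral_le_lintegral_enorm _).trans ?_
    refine setLIntegral_mono (by fun_prop) fun s hs => ?_
    rw [mul_one]
    refine (enorm_add_le _ _).trans (add_le_add le_rfl ?_)
    rw [enorm_mul]
    refine mul_le_of_le_one_left zero_le ?_
    rw [Real.enorm_eq_ofReal_abs]
    refine ENNReal.ofReal_le_one.2 (abs_le.2 ⟨?_, ?_⟩) <;> linarith [hs.1, hs.2]
  calc ‖v a‖ₑ ^ 2 ≤ (∫⁻ s in Set.Ioc a (a + 1), (‖v s‖ₑ + ‖v' s‖ₑ) * 1) ^ 2 :=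
        pow_le_pow_left₀ zero_le hle 2
    _ ≤ (∫⁻ s in Set.Ioc a (a + 1), (‖v s‖ₑ + ‖v' s‖ₑ) ^ 2 * 1)
          * ∫⁻ _s in Set.Ioc a (a + 1), 1 := sq_lintegral_mul_le (by fun_prop) (by fun_prop)
    _ = ∫⁻ s in Set.Ioc a (a + 1), (‖v s‖ₑ + ‖v' s‖ₑ) ^ 2 := by simp
    _ ≤ ∫⁻ s, (‖v s‖ₑ + ‖v' s‖ₑ) ^ 2 := setLIntegral_le_lintegral _ _
    _ ≤ ∫⁻ s, 2 * (‖v s‖ₑ ^ 2 + ‖v' s‖ₑ ^ 2) := lintegral_mono fun s => by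
        have := ENNReal.rpow_add_le_mul_rpow_add_rpow ‖v s‖ₑ ‖v' s‖ₑ (p := 2) (by norm_num)
        norm_num at this
        exact this
    _ = _ := lintegral_const_mul _ (by fun_prop)

theorem enorm_sq_le_lintegral_update {n : ℕ} {u : SpaceTime n → ℝ} (hu : ContDiff ℝ ∞ u)
    (i : Fin (n + 1)) (x : Fin (n + 1) → ℝ) :
    ‖u (WithLp.toLp 2 x)‖ₑ ^ 2 ≤ 2 * ∫⁻ s, (‖u (WithLp.toLp 2 (Function.update x i s))‖ₑ ^ 2
      + ‖partialD i u (WithLp.toLp 2 (Function.update x i s))‖ₑ ^ 2) := by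
  have hup : ∀ s : ℝ, WithLp.toLp 2 (Function.update x i s)
      = WithLp.toLp 2 x + (s - x i) • EuclideanSpace.single i (1 : ℝ) := fun s => by
    ext j
    by_cases hj : j = i
    · subst hj; simp
    · simp [hj]
  have hline : ∀ s : ℝ, HasDerivAt
      (fun s : ℝ => WithLp.toLp 2 x + (s - x i) • EuclideanSpace.single i (1 : ℝ))
      (EuclideanSpace.single i (1 : ℝ)) s := fun s => by
    simpa using (((hasDerivAt_id s).sub_const (x i)).smul_const
      (EuclideanSpace.single i (1 : ℝ))).const_add (WithLp.toLp 2 x)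
  have hder : ∀ s : ℝ, HasDerivAt (fun s => u (WithLp.toLp 2 (Function.update x i s)))
      (partialD i u (WithLp.toLp 2 (Function.update x i s))) s := fun s => by
    simp_rw [hup]
    exact ((hu.differentiable (by simp)) _).hasFDerivAt.comp_hasDerivAt s (hline s)
  have hcont : Continuous fun s => partialD i u (WithLp.toLp 2 (Function.update x i s)) := by
    simp_rw [hup]
    have := (contDiff_partialD hu i).continuous
    fun_prop
  have := enorm_sq_le_lintegral_line hder hcont (x i)
  rwa [Function.update_eq_self] at this

theorem sum_enorm_sq_le_lintegral_update {n : ℕ} (L : List (SpaceTime n → ℝ))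
    (hL : ∀ u ∈ L, ContDiff ℝ ∞ u) (i : Fin (n + 1)) (x : Fin (n + 1) → ℝ) :
    (L.map fun u => ‖u (WithLp.toLp 2 x)‖ₑ ^ 2).sum ≤
      2 * ∫⁻ s, ((L.map fun u => ‖u (WithLp.toLp 2 (Function.update x i s))‖ₑ ^ 2).sum
      + (L.map fun u => ‖partialD i u (WithLp.toLp 2 (Function.update x i s))‖ₑ ^ 2).sum) := by
  induction L with
  | nil => simp
  | cons u L ih =>
    have hu := hL u (by simp)
    simp only [List.map_cons, List.sum_cons]
    have hc := hu.continuous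
    have hc' := (contDiff_partialD hu i).continuous
    have hm : Measurable fun s : ℝ =>
        ‖u (WithLp.toLp 2 (Function.update x i s))‖ₑ ^ 2
          + ‖partialD i u (WithLp.toLp 2 (Function.update x i s))‖ₑ ^ 2 := by
      have : Continuous fun s : ℝ => Function.update x i s := continuous_const.update i continuous_id
      have h1 := (hc.comp ((PiLp.continuous_toLp 2 _).comp this)).measurable
      have h2 := (hc'.comp ((PiLp.continuous_toLp 2 _).comp this)).measurable
      exact (h1.enorm.pow_const 2).add (h2.enorm.pow_const 2)
    calc _ ≤ _ := add_le_add (enorm_sq_le_lintegral_update hu i x)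
          (ih fun v hv => hL v (by simp [hv]))
      _ = _ := by
        rw [← mul_add, ← lintegral_add_left hm]
        congr 1
        refine lintegral_congr fun s => ?_
        ring

/-- Each new coordinate `i` costs a factor 2 and an integration, and replaces the family of
derivatives by itself together with its `∂ᵢ`. This matches how the sublists of `i :: l` arise from
those of `l`. -/
theorem enorm_sq_le_lmarginal {n : ℕ} {u : SpaceTime n → ℝ} (hu : ContDiff ℝ ∞ u)
    {l : List (Fin (n + 1))} (hl : l.Nodup) (x : Fin (n + 1) → ℝ) :
    ‖u (WithLp.toLp 2 x)‖ₑ ^ 2 ≤ 2 ^ l.length * lmarginal (fun _ => volume) l.toFinset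
      (fun y => (l.sublists'.map fun s => ‖listPartial s u (WithLp.toLp 2 y)‖ₑ ^ 2).sum) x := by
  have hmeas : ∀ l : List (Fin (n + 1)), Measurable fun y : Fin (n + 1) → ℝ =>
      (l.sublists'.map fun s => ‖listPartial s u (WithLp.toLp 2 y)‖ₑ ^ 2).sum := fun l => by
    induction l.sublists' with
    | nil => simp
    | cons s L ih =>
      simp only [List.map_cons, List.sum_cons]
      have h1 := ((contDiff_listPartial hu s).continuous.comp (PiLp.continuous_toLp 2 _)).measurable
      exact (h1.enorm.pow_const 2).add ih
  induction l with
  | nil => simp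
  | cons i l ih =>
    obtain ⟨hi, hl'⟩ := List.nodup_cons.1 hl
    refine (ih hl').trans ?_
    rw [List.toFinset_cons, lmarginal_insert' _ (hmeas _) (by simpa using hi), List.length_cons,
      pow_succ, mul_assoc]
    gcongr
    have h2 : Measurable fun y : Fin (n + 1) → ℝ => ∫⁻ s : ℝ,
        ((i :: l).sublists'.map fun t =>
          ‖listPartial t u (WithLp.toLp 2 (Function.update y i s))‖ₑ ^ 2).sum := by
      have := (hmeas (i :: l)).lmarginal (fun _ : Fin (n + 1) => (volume : Measure ℝ)) (s := {i})
      rwa [lmarginal_singleton] at this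
    unfold lmarginal
    rw [← lintegral_const_mul' _ _ (by norm_num)]
    refine lintegral_mono fun y => ?_
    have := sum_enorm_sq_le_lintegral_update (l.sublists'.map fun s => listPartial s u)
      (by simpa using fun s _ => contDiff_listPartial hu s) i
      (Function.updateFinset x l.toFinset y)
    simpa [List.sublists'_cons, Function.comp_def] using this

theorem enorm_sq_le_sum_lintegral {n : ℕ} {u : SpaceTime n → ℝ} (hu : ContDiff ℝ ∞ u)
    (z : SpaceTime n) :
    ‖u z‖ₑ ^ 2 ≤ 2 ^ (n + 1) *
      ((List.finRange (n + 1)).sublists'.map fun s => ∫⁻ y, ‖listPartial s u y‖ₑ ^ 2).sum := by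
  have h := enorm_sq_le_lmarginal hu (List.nodup_finRange (n + 1)) (WithLp.ofLp z)
  have huniv : (List.finRange (n + 1)).toFinset = Finset.univ := by ext; simp
  rw [huniv, lmarginal_univ, List.length_finRange] at h
  refine h.trans (le_of_eq ?_)
  congr 1
  induction (List.finRange (n + 1)).sublists' with
  | nil => simp
  | cons s L ih =>
    simp only [List.map_cons, List.sum_cons]
    have hc := (contDiff_listPartial hu s).continuous
    have h1 := (hc.comp (PiLp.continuous_toLp 2 _)).measurable
    refine (lintegral_add_left (h1.enorm.pow_const 2) _).trans ?_
    refine congrArg₂ _ ?_ ih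
    exact (PiLp.volume_preserving_toLp (Fin (n + 1))).lintegral_comp
      (hc.measurable.enorm.pow_const 2)

end ParabolicSobolev

namespace ParabolicSobolev

open Filter Topology

/-! ### The Sobolev embedding -/

theorem lintegral_enorm_normed {n : ℕ} (φ : ContDiffBump (0 : SpaceTime n)) :
    ∫⁻ z, ‖φ.normed volume z‖ₑ = 1 := by
  have h : ∀ z, ‖φ.normed volume z‖ₑ = ENNReal.ofReal (φ.normed volume z) := fun z =>
    Real.enorm_of_nonneg (φ.nonneg_normed z)
  simp_rw [h]
  rw [← ofReal_integral_eq_lintegral_ofReal φ.integrable_normed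
    (Eventually.of_forall φ.nonneg_normed), φ.integral_normed, ENNReal.ofReal_one]

theorem conv_eq_convolution_lsmul {n : ℕ} (g φ : SpaceTime n → ℝ) :
    conv g φ = convolution φ g (ContinuousLinearMap.lsmul ℝ ℝ) volume := by
  rw [← convolution_flip]
  ext z
  exact integral_congr_ae (Eventually.of_forall fun t => mul_comm _ _)

/-- If all mixed derivatives `∂^α g`, `α ∈ {0, 1}ⁿ⁺¹`, have `L²` norm at most `A`, then `g` is
bounded by a multiple of `A`. -/
theorem normLinf_le_of_weak_listPartial {n : ℕ} {g : SpaceTime n → ℝ} {A : ℝ≥0∞}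
    (hg : LocallyIntegrable g volume)
    (H : ∀ s : List (Fin (n + 1)), s.Sublist (List.finRange (n + 1)) →
      ∃ h : SpaceTime n → ℝ, AEStronglyMeasurable h volume ∧ eLpNorm h 2 volume ≤ A ∧
        ∀ ψ : SpaceTime n → ℝ, ContDiff ℝ ∞ ψ → HasCompactSupport ψ →
          ∫ z, g z * listPartial s ψ z = (-1) ^ s.length * ∫ z, h z * ψ z) :
    normLinf g ≤ 2 ^ (n + 1) * A := by
  have hbound : ∀ (φ : ContDiffBump (0 : SpaceTime n)) (z : SpaceTime n),
      ‖conv g (φ.normed volume) z‖ₑ ≤ 2 ^ (n + 1) * A := by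
    intro φ z
    have hφ : ContDiff ℝ ∞ (φ.normed volume) := φ.contDiff_normed
    have hc : HasCompactSupport (φ.normed volume) := φ.hasCompactSupport_normed
    have h := enorm_sq_le_sum_lintegral (contDiff_conv hg hφ hc) z
    have hsum : ((List.finRange (n + 1)).sublists'.map fun s =>
        ∫⁻ y, ‖listPartial s (conv g (φ.normed volume)) y‖ₑ ^ 2).sum ≤ 2 ^ (n + 1) * A ^ 2 := by
      refine (List.sum_le_card_nsmul _ (A ^ 2) ?_).trans (by simp)
      intro a ha
      obtain ⟨s, hs, rfl⟩ := List.mem_map.1 ha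
      obtain ⟨k, hk, hkA, hweak⟩ := H s (List.mem_sublists'.1 hs)
      rw [listPartial_conv hg hφ hc, conv_listPartial_of_weak hweak hφ hc]
      exact (lintegral_conv_sq_le hk hφ.continuous.measurable (lintegral_enorm_normed φ)).trans
        (pow_le_pow_left₀ zero_le hkA 2)
    refine (ENNReal.pow_le_pow_left_iff two_ne_zero).1 ?_
    calc _ ≤ _ := h
      _ ≤ 2 ^ (n + 1) * (2 ^ (n + 1) * A ^ 2) := by gcongr
      _ = _ := by ring
  -- The fixed ratio 2 of outer to inner radius is what the almost everywhere convergence of the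
  -- mollifications requires.
  let φ : ℕ → ContDiffBump (0 : SpaceTime n) := fun k =>
    ⟨1 / ((k : ℝ) + 1), 2 * (1 / ((k : ℝ) + 1)), by positivity, by
      have : 0 < 1 / ((k : ℝ) + 1) := by positivity
      linarith⟩
  have hlim : Tendsto (fun k => (φ k).rOut) atTop (𝓝 0) := by
    have := (tendsto_one_div_add_atTop_nhds_zero_nat (𝕜 := ℝ)).const_mul 2
    rwa [mul_zero] at this
  have hae := ContDiffBump.ae_convolution_tendsto_right_of_locallyIntegrable (K := 2) hlim
    (Eventually.of_forall fun k => le_rfl) hg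
  refine eLpNormEssSup_le_of_ae_enorm_bound ?_ |> (by rw [normLinf, eLpNorm_exponent_top]; exact ·)
  filter_upwards [hae] with z hz
  refine le_of_tendsto hz.enorm (Eventually.of_forall fun k => ?_)
  rw [← conv_eq_convolution_lsmul]
  exact hbound (φ k) z

/-! ### Admissible pairs and the logarithmic inequalities -/

theorem vecNorm_normW_ne_top {n m : ℕ} {f : Fin (n + 1) → SpaceTime n → ℝ}
    (hf : ∀ i, MemW m (f i)) : vecNorm (normW m) f ≠ ⊤ := by
  refine ((Finset.sup_lt_iff (by simp)).2 fun i _ => ?_).ne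
  exact ENNReal.sum_lt_top.2 fun α hα => ((hf i).2 α (mem_parIndices.1 hα)).2.2

theorem Admissible.normLinf_le {n m : ℕ} {g : SpaceTime n → ℝ}
    {f : Fin (n + 1) → SpaceTime n → ℝ} (h : Admissible m g f) (hnm : n + 1 ≤ 2 * m) :
    normLinf g ≤ 2 ^ (n + 1) * (1 + vecNorm (normW m) f) := by
  refine normLinf_le_of_weak_listPartial (h.memLp.locallyIntegrable one_le_two) fun s hs => ?_
  rcases s with _ | ⟨i, s⟩
  -- The empty list is `g` itself, the source of the summand 1.
  · exact ⟨g, h.memLp.1, h.norm_le_one.trans le_self_add, by simp⟩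
  have hnd := hs.nodup (List.nodup_finRange _)
  have hs' : s.Sublist (List.finRange (n + 1)) := (List.sublist_cons_self i s).trans hs
  have hord : parOrder (listIndex s) ≤ 2 * m :=
    (parOrder_listIndex_le (List.nodup_cons.1 hnd).1).trans hnm
  obtain ⟨hw, hL⟩ := (h.memW i).2 _ hord
  refine ⟨_, hL.1, ?_, fun ψ hψ hc => ?_⟩
  · calc _ ≤ normW m (f i) := Finset.single_le_sum
          (f := fun α => eLpNorm (weakPartial α (f i)) 2 volume) (fun _ _ => zero_le)
          (mem_parIndices.2 hord)
      _ ≤ vecNorm (normW m) f := Finset.le_sup (f := fun i => normW m (f i)) (Finset.mem_univ i)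
      _ ≤ _ := le_add_self
  -- Testing the weak gradient against `∂^s ψ` moves `∂ᵢ` onto `f i`; the weak derivative of `f i`
  -- then absorbs `∂^s`.
  · have h1 := (h.isWeakGradient i).2.2 _ (contDiff_listPartial hψ s)
      (hasCompactSupport_listPartial hc s)
    have h2 := hw.2.2 ψ hψ hc
    rw [← listIndex_singleton, iterPartial_listIndex (by simp), sum_listIndex (by simp)] at h1
    rw [iterPartial_listIndex hs', sum_listIndex (List.nodup_cons.1 hnd).2] at h2
    simp only [listPartial_cons, listPartial_nil, List.length_cons, List.length_nil] at h1 ⊢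
    rw [h1, h2]
    ring

theorem Admissible.sqrtLogTerm_le {n m : ℕ} {g : SpaceTime n → ℝ}
    {f : Fin (n + 1) → SpaceTime n → ℝ} (h : Admissible m g f) (hnm : n + 1 ≤ 2 * m) :
    sqrtLogTerm m g f ≤ (1 + Real.posLog (1 + 2 ^ (n + 1)) + Real.log 2) *
      (1 + Real.posLog (wNorm m f)) := by
  have hW := vecNorm_normW_ne_top h.memW
  have hg : (normLinf g).toReal ≤ 2 ^ (n + 1) * (1 + wNorm m f) := by
    -- Finiteness of the right side matters: `toReal` would send `⊤` to 0.
    have := ENNReal.toReal_mono (by finiteness) (h.normLinf_le hnm)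
    rwa [ENNReal.toReal_mul, ENNReal.toReal_add (by simp) hW, ENNReal.toReal_pow,
      ENNReal.toReal_one, ENNReal.toReal_ofNat] at this
  have hW0 : 0 ≤ wNorm m f := ENNReal.toReal_nonneg
  have hG0 : 0 ≤ (normLinf g).toReal := ENNReal.toReal_nonneg
  have hlog : Real.posLog (wNorm m f + (normLinf g).toReal)
      ≤ Real.posLog (1 + 2 ^ (n + 1)) + Real.log 2 + Real.posLog (wNorm m f) := by
    calc _ ≤ Real.posLog ((1 + 2 ^ (n + 1)) * (1 + wNorm m f)) :=
          Real.posLog_le_posLog (by positivity) (by nlinarith)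
      _ ≤ Real.posLog (1 + 2 ^ (n + 1)) + Real.posLog (1 + wNorm m f) := Real.posLog_mul
      _ ≤ _ := by
        have := Real.posLog_add (x := 1) (y := wNorm m f)
        rw [Real.posLog_one] at this
        linarith
  have hsqrt : ∀ x : ℝ, 0 ≤ x → √x ≤ 1 + x := fun x hx =>
    Real.sqrt_le_iff.2 ⟨by positivity, by nlinarith⟩
  have h1 : 0 ≤ Real.posLog (1 + 2 ^ (n + 1) : ℝ) := Real.posLog_nonneg
  have h2 : 0 ≤ Real.posLog (wNorm m f) := Real.posLog_nonneg
  have h3 : 0 ≤ Real.log 2 := Real.log_nonneg one_le_two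
  unfold sqrtLogTerm
  refine (hsqrt _ Real.posLog_nonneg).trans ?_
  nlinarith [mul_nonneg h1 h2, mul_nonneg h3 h2]

/-- The maximum with 1 lets the constant also absorb the summand 1, which carries no logarithmic
factor. -/
theorem OgawaInequality.logSobolevInequality {n m : ℕ} {C C₀ : ℝ} {g : SpaceTime n → ℝ}
    {f : Fin (n + 1) → SpaceTime n → ℝ} (hO : OgawaInequality m C₀ g f) (hC₀ : 0 < C₀)
    (hC : sqrtLogTerm m g f ≤ C * (1 + Real.posLog (wNorm m f))) :
    LogSobolevInequality m (C₀ * max 1 C) f := by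
  refine le_trans hO ?_
  have hL : 0 ≤ 1 + Real.posLog (wNorm m f) := add_nonneg zero_le_one Real.posLog_nonneg
  have h1 : ENNReal.ofReal (sqrtLogTerm m g f)
      ≤ ENNReal.ofReal (max 1 C) * ENNReal.ofReal (1 + Real.posLog (wNorm m f)) := by
    rw [← ENNReal.ofReal_mul (by positivity)]
    exact ENNReal.ofReal_le_ofReal (hC.trans (mul_le_mul_of_nonneg_right (le_max_right _ _) hL))
  have h2 : (1 : ℝ≥0∞) ≤ ENNReal.ofReal (max 1 C) :=
    ENNReal.one_le_ofReal.2 (le_max_left _ _)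
  rw [ENNReal.ofReal_mul hC₀.le, mul_assoc]
  gcongr
  rw [mul_add, mul_one, mul_left_comm]
  gcongr

end ParabolicSobolev

open ParabolicSobolev
theorem theorem3 (n m : ℕ) (hn : n = 1 ∨ n = 2 ∨ n = 3) (hm : 1 ≤ m)
    (hnm : ((n : ℝ) + 2) / 2 < 2 * (m : ℝ)) :
    (∃ C : ℝ, 0 < C ∧ ∀ (g : SpaceTime n → ℝ) (f : Fin (n + 1) → SpaceTime n → ℝ),
      Admissible m g f →
        MemLp g ∞ volume ∧ sqrtLogTerm m g f ≤ C * (1 + Real.posLog (wNorm m f))) ∧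
    (∀ C₀ : ℝ, 0 < C₀ → ∃ C₁ : ℝ, 0 < C₁ ∧
      ∀ (g : SpaceTime n → ℝ) (f : Fin (n + 1) → SpaceTime n → ℝ), Admissible m g f →
        OgawaInequality m C₀ g f → LogSobolevInequality m C₁ f) := by
  -- This is where `n ≤ 3` enters: `4 * m > n + 2` gives `m ≥ 2` for `n = 2, 3`, while `m ≥ 1`
  -- suffices for `n = 1`.
  have hle : n + 1 ≤ 2 * m := by
    have : n + 2 < 4 * m := by
      have h : (n : ℝ) + 2 < 4 * m := by linarith
      exact_mod_cast h
    omega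
  refine ⟨⟨_, ?_, fun g f h => ⟨⟨h.memLp.1, ?_⟩, h.sqrtLogTerm_le hle⟩⟩, fun C₀ hC₀ =>
    ⟨_, ?_, fun g f h hO => hO.logSobolevInequality hC₀ (h.sqrtLogTerm_le hle)⟩⟩
  · have h1 : 0 ≤ Real.posLog (1 + 2 ^ (n + 1) : ℝ) := Real.posLog_nonneg
    have h3 : 0 ≤ Real.log 2 := Real.log_nonneg one_le_two
    linarith
  · have hW := vecNorm_normW_ne_top h.memW
    exact (h.normLinf_le hle).trans_lt (by finiteness)
  · positivity
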